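/- Let $\alpha>-1$, $N\ge 0$, and let $a_1>a_2>\dots>a_N\ge 0$. For $b\ge 0$ put $$w_\alpha(x,b)=\frac{x^\alpha e^{-x}}{\Gamma(\alpha+1)}\,{}_0F_1(\alpha+1;bx),\qquad x\ge 0 ,$$ and for $1\le i,k\le N$ let $$\eta_k(x)=(-1)^{k-1}(k-1)!\,L^{\alpha}_{k-1}(x),\qquad \xi_i(x)=w_\alpha(x,a_i),$$ where $L^\alpha_n$ is the associated Laguerre polynomial of degree $n$. The kernel of the chiral Gaussian unitary ensemble perturbed by a source with parameters $a_1,\dots,a_N$ is the kernel of the biorthogonal ensemble on $[0,\infty)$ given by these functions: $$K_N(x,y)=\sum_{i,j=1}^N\eta_i(x)\,c_{i,j}\,\xi_j(y),\qquad \sum_{k=1}^N g_{i,k}c_{j,k}=\delta_{i,j},\qquad g_{i,j}=\int_0^\infty \eta_i(x)\xi_j(x)\,dx .$$ For a multi-index $\vec n=(n_1,\dots,n_N)$ of non-negative integers, with $|\vec n|=\sum_i n_i$, and the weights $w^{(i)}(x)=w_\alpha(x,a_i)$ on $[0,\infty)$: * the multiple polynomials of type I are polynomials $A^{(1)}_{\vec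 n},\dots,A^{(N)}_{\vec n}$ with $\deg A^{(i)}_{\vec n}\le n_i-1$ (so $A^{(i)}_{\vec n}=0$ if $n_i=0$) such that the type I multiple function $Q_{\vec n}=\sum_i w^{(i)}A^{(i)}_{\vec n}$ satisfies $\int_0^\infty x^jQ_{\vec n}(x)\,dx=0$ for $0\le j\le|\vec n|-2$ and $=1$ for $j=|\vec n|-1$; * the multiple polynomial of type II is a monic polynomial $P_{\vec n}$ of degree $|\vec n|$ with $\int_0^\infty w^{(i)}(x)x^jP_{\vec n}(x)\,dx=0$ for $0\le j\le n_i-1$, $1\le i\le N$. Let $\vec n^{(0)}=(0,\dots,0)$, $\vec n^{(1)}=(1,0,\dots,0)$, $\vec n^{(2)}=(1,1,0,\dots,0)$, …, $\vec n^{(N)}=(1,\dots,1)$. Then: 1. The functions $x^j w_\alpha(x,a_i)$ ($j\ge 0$, $1\le i\le N$) are integrable on $[0,\infty)$ and the matrix $(g_{i,j})$ is nonsingular, so that $K_N$ is well defined. 2. For every $0\le k\le N$ the type II polynomial and the type I polynomials with multi-index $\vec n^{(k)}$ exist and are unique; moreover $A^{(i)}_{\vec n^{(k)}}$ has degree exactly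 $0$ for $1\le i\le k$. 3. With $P_i=P_{\vec n^{(i)}}$ and $Q_i=Q_{\vec n^{(i+1)}}$ for $0\le i\le N-1$, one has for all $x,y\ge 0$ ($y>0$ if $\alpha<0$) $$K_N(x,y)=\sum_{i=0}^{N-1}P_i(x)\,Q_i(y).$$ -/

import Mathlib

open MeasureTheory Polynomial

/-! ### Biorthogonal ensembles and their kernel -/

/-- The matrix of pairings `g i j = ∫ x in I, η i x * ξ j x`. -/
noncomputable def pairingMatrix {N : ℕ} (I : Set ℝ) (η ξ : Fin N → ℝ → ℝ) :
    Matrix (Fin N) (Fin N) ℝ :=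
  Matrix.of fun i j => ∫ x in I, η i x * ξ j x

/-- The kernel `K_N(x, y) = ∑ i j, η i x * c i j * ξ j y` of the biorthogonal ensemble with
density proportional to `det (η i (x j)) * det (ξ i (x j))` on `I ^ N`. The matrix `c` is given by
`∑ k, g i k * c j k = δ i j`, i.e. it is the transpose of the inverse of the pairing matrix `g`
(which has to be nonsingular). -/
noncomputable def biorthogonalKernel {N : ℕ} (I : Set ℝ) (η ξ : Fin N → ℝ → ℝ) (x y : ℝ) : ℝ :=
  ∑ i, ∑ j, η i x * ((pairingMatrix I η ξ)⁻¹).transpose i j * ξ j y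

/-! ### Multiple functions of type I and II -/

/-- The weight `|n| = n 1 + ⋯ + n D` of a multi-index. -/
def multiIndexWeight {D : ℕ} (n : Fin D → ℕ) : ℕ := ∑ i, n i

/-- The function `Q(x) = ∑ i, w i x * A i x` generated by polynomials `A 1, …, A D`. -/
noncomputable def typeIFunction {D : ℕ} (w : Fin D → ℝ → ℝ) (A : Fin D → ℝ[X]) (x : ℝ) : ℝ :=
  ∑ i, w i x * (A i).eval x

/-- `A 1, …, A D` are the multiple polynomials of type I with multi-index `n` for the weights
`w 1, …, w D` on `I`: the degree of `A i` is at most `n i - 1` (so `A i = 0` if `n i = 0`), and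
`Q = ∑ i, w i * A i` satisfies `∫ x ^ j * Q = 0` for `j = 0, …, |n| - 2` and
`∫ x ^ j * Q = 1` for `j = |n| - 1`. -/
structure IsMultipleTypeI {D : ℕ} (I : Set ℝ) (w : Fin D → ℝ → ℝ) (n : Fin D → ℕ)
    (A : Fin D → ℝ[X]) : Prop where
  degree_lt : ∀ i, (A i).degree < n i
  integral_eq_zero : ∀ j : ℕ, j + 1 < multiIndexWeight n →
    ∫ x in I, x ^ j * typeIFunction w A x = 0
  integral_eq_one : ∀ j : ℕ, j + 1 = multiIndexWeight n →
    ∫ x in I, x ^ j * typeIFunction w A x = 1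

/-- `P` is the multiple polynomial of type II with multi-index `n` for the weights
`w 1, …, w D` on `I`: it is monic of degree `|n|`, and `∫ w i * x ^ j * P = 0` for
`j = 0, …, n i - 1` and every `i`. -/
structure IsMultipleTypeII {D : ℕ} (I : Set ℝ) (w : Fin D → ℝ → ℝ) (n : Fin D → ℕ)
    (P : ℝ[X]) : Prop where
  monic : P.Monic
  natDegree_eq : P.natDegree = multiIndexWeight n
  integral_eq_zero : ∀ i, ∀ j < n i, ∫ x in I, w i x * x ^ j * P.eval x = 0

/-- The multi-index `(1, …, 1, 0, …, 0)` of length `N` which begins with `k` ones. -/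
def nestedIndex (N k : ℕ) : Fin N → ℕ := fun j => if (j : ℕ) < k then 1 else 0

/-! ### The chiral Gaussian unitary ensemble with a source term -/

/-- The hypergeometric function `₀F₁(c; z) = ∑ k, z ^ k / ((c)_k * k!)` for real arguments. -/
noncomputable def hyp0F1 (c z : ℝ) : ℝ :=
  ∑' k : ℕ, z ^ k / ((ascPochhammer ℝ k).eval c * (k.factorial : ℝ))

/-- The associated Laguerre polynomial
`L_n^α(x) = ∑ k ≤ n, (-1) ^ k * Γ(n + α + 1) / (Γ(k + α + 1) * (n - k)! * k!) * x ^ k`,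
for `α > -1`. -/
noncomputable def assocLaguerre (α : ℝ) (n : ℕ) : ℝ[X] :=
  ∑ k ∈ Finset.range (n + 1),
    C ((-1) ^ k * Real.Gamma (n + α + 1) /
      (Real.Gamma (k + α + 1) * ((n - k).factorial : ℝ) * (k.factorial : ℝ))) * X ^ k

/-- The weight `w_α(x, b) = x ^ α * exp (-x) * ₀F₁(α + 1; b * x) / Γ(α + 1)`. -/
noncomputable def chiralWeight (α b x : ℝ) : ℝ :=
  x ^ α * Real.exp (-x) / Real.Gamma (α + 1) * hyp0F1 (α + 1) (b * x)

/-- The functions `η_{k + 1} = (-1) ^ k * k! * L_k^α` of the ensemble (numbered from zero). -/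
noncomputable def chiralEta (α : ℝ) (k : ℕ) (x : ℝ) : ℝ :=
  (-1) ^ k * (k.factorial : ℝ) * (assocLaguerre α k).eval x

/-- The kernel `K_N` of the perturbed chiral Gaussian unitary ensemble with source
parameters `a 1, …, a N`: the biorthogonal ensemble on `[0, ∞)` with
`η_{k + 1} = (-1) ^ k * k! * L_k^α` and `ξ_i(x) = w_α(x, a i)`. -/
noncomputable def chiralKernel {N : ℕ} (α : ℝ) (a : Fin N → ℝ) (x y : ℝ) : ℝ :=
  biorthogonalKernel (Set.Ici 0) (fun i => chiralEta α i) (fun i => chiralWeight α (a i)) x y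

/-! ### Moments of the weights -/

/-! Integrating the `₀F₁` series termwise gives `∫ p(x) w_α(x,b) dx = exp b * (T p)(b)`
(`integral_eval_mul_chiralWeight`), where `T = momentTransform α` is linear and preserves degree and
leading coefficient. Everything thus becomes evaluation of polynomials at the distinct nodes `a i`.

Type II for `nestedIndex N k`: `T P` is monic of degree `k` and vanishes at the first `k` nodes, so
it is their nodal polynomial. Type I: the constants `d i` must make `q ↦ ∑ d i * exp (a i) * q (a
i)` the coefficient of `X ^ (k - 1)` in degree `< k`, which is the divided difference. The pairing
matrix is a Vandermonde matrix up to exponential factors and a unipotent change of basis.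

Consequently `∫ P_i Q_l = δ_{i,l}`. The kernel depends only on the spans of the `η`'s and the `ξ`'s,
so it is diagonal in these bases (`transpose_inv_mul_eq`). -/

/-- The monic polynomials `q` of degree `j` with
`∑ k, b ^ k / k! * (c + k) (c + k + 1) ⋯ (c + k + j - 1) = exp b * q b`. -/
noncomputable def momentPoly : ℕ → ℝ → ℝ[X]
  | 0, _ => 1
  | j + 1, c => C c * momentPoly j (c + 1) + X * momentPoly j (c + 2)

/-- Split the first factor `c + k` of the rising factorial: `c` leaves the case `c + 1`, while `k`
cancels against `k!` and an index shift leaves the case `c + 2`. -/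
theorem hasSum_momentPoly (b : ℝ) (j : ℕ) (c : ℝ) :
    HasSum (fun k : ℕ => b ^ k / (k.factorial : ℝ) * (ascPochhammer ℝ j).eval (c + k))
      (Real.exp b * (momentPoly j c).eval b) := by
  induction j generalizing c with
  | zero =>
    simpa [momentPoly, Real.exp_eq_exp_ℝ] using NormedSpace.expSeries_div_hasSum_exp b
  | succ j ih =>
    have h1 := (ih (c + 1)).mul_left c
    have h2 : HasSum (fun k : ℕ => b ^ k / (k.factorial : ℝ) * k *
        (ascPochhammer ℝ j).eval (c + 1 + k)) (b * (Real.exp b * (momentPoly j (c + 2)).eval b)) := by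
      -- The factor `k` kills the term `k = 0`, so the shift costs nothing.
      refine (hasSum_nat_add_iff' 1).mp ?_
      have e1 : (fun k : ℕ => b ^ (k + 1) / ((k + 1).factorial : ℝ) * (k + 1 : ℕ) *
          (ascPochhammer ℝ j).eval (c + 1 + (k + 1 : ℕ))) = fun k : ℕ =>
          b * (b ^ k / (k.factorial : ℝ) * (ascPochhammer ℝ j).eval (c + 2 + k)) := by
        funext k
        have e : c + 1 + ((k + 1 : ℕ) : ℝ) = c + 2 + k := by push_cast; ring
        rw [e, Nat.factorial_succ]
        push_cast
        have : (k.factorial : ℝ) ≠ 0 := by positivity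
        field_simp
        ring
      rw [e1]
      simpa using (ih (c + 2)).mul_left b
    have e2 : (fun k : ℕ => b ^ k / (k.factorial : ℝ) * (ascPochhammer ℝ (j + 1)).eval (c + k)) =
        fun k : ℕ => c * (b ^ k / (k.factorial : ℝ) * (ascPochhammer ℝ j).eval (c + 1 + k)) +
          b ^ k / (k.factorial : ℝ) * k * (ascPochhammer ℝ j).eval (c + 1 + k) := by
      funext k
      have e : c + k + 1 = c + 1 + k := by ring
      rw [ascPochhammer_succ_left]
      simp only [eval_mul, eval_X, eval_comp, eval_add, eval_one, e]
      ring
    have e3 : Real.exp b * (momentPoly (j + 1) c).eval b =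
        c * (Real.exp b * (momentPoly j (c + 1)).eval b) +
          b * (Real.exp b * (momentPoly j (c + 2)).eval b) := by
      simp only [momentPoly, eval_add, eval_mul, eval_C, eval_X]
      ring
    rw [e2, e3]
    exact h1.add h2

theorem momentPoly_monic_natDegree (j : ℕ) (c : ℝ) :
    (momentPoly j c).Monic ∧ (momentPoly j c).natDegree = j := by
  induction j generalizing c with
  | zero => simp [momentPoly]
  | succ j ih =>
    obtain ⟨-, d1⟩ := ih (c + 1)
    obtain ⟨m2, d2⟩ := ih (c + 2)
    have m3 : (X * momentPoly j (c + 2)).Monic := monic_X.mul m2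
    have d3 : (X * momentPoly j (c + 2)).natDegree = j + 1 := by
      rw [natDegree_X_mul m2.ne_zero, d2]
    have hlt : (C c * momentPoly j (c + 1)).degree < (X * momentPoly j (c + 2)).degree := by
      rw [degree_eq_natDegree m3.ne_zero, d3]
      refine (degree_le_of_natDegree_le ((natDegree_C_mul_le _ _).trans d1.le)).trans_lt ?_
      exact_mod_cast j.lt_succ_self
    exact ⟨m3.add_of_right hlt, (natDegree_add_eq_right_of_degree_lt hlt).trans d3⟩

theorem Gamma_add_natCast_eq {s : ℝ} (hs : 0 < s) (n : ℕ) :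
    Real.Gamma (s + n) = (ascPochhammer ℝ n).eval s * Real.Gamma s := by
  induction n with
  | zero => simp
  | succ n ih =>
    have : s + ((n + 1 : ℕ) : ℝ) = s + n + 1 := by push_cast; ring
    rw [this, Real.Gamma_add_one (by positivity), ih, ascPochhammer_succ_eval]
    ring

/-- Each series term is a Gamma integral `Γ(α + 1 + k + j)`; dividing by `(α + 1)_k Γ(α + 1)` leaves
`(α + 1 + k)_j`. The terms are nonnegative because `b ≥ 0`, so summability of the integrals already
justifies the interchange. -/
theorem integral_pow_mul_chiralWeight {α : ℝ} (hα : -1 < α) {b : ℝ} (hb : 0 ≤ b) (j : ℕ) :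
    ∫ x in Set.Ici 0, x ^ j * chiralWeight α b x =
      Real.exp b * (momentPoly j (α + 1)).eval b := by
  have hα' : 0 < α + 1 := by linarith
  have hΓ : 0 < Real.Gamma (α + 1) := Real.Gamma_pos_of_pos hα'
  have hasc : ∀ k, 0 < (ascPochhammer ℝ k).eval (α + 1) := fun k => ascPochhammer_pos k _ hα'
  let F : ℕ → ℝ → ℝ := fun k x =>
    b ^ k / ((ascPochhammer ℝ k).eval (α + 1) * (k.factorial : ℝ) * Real.Gamma (α + 1)) *
      (Real.exp (-x) * x ^ ((α + 1 + k + j : ℝ) - 1))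
  have hpos : ∀ k : ℕ, 0 < α + 1 + k + j := fun k => by positivity
  have hF : ∀ k, IntegrableOn (F k) (Set.Ioi 0) := fun k =>
    (Real.GammaIntegral_convergent (hpos k)).const_mul _
  have hFint : ∀ k, ∫ x in Set.Ioi 0, F k x =
      b ^ k / (k.factorial : ℝ) * (ascPochhammer ℝ j).eval (α + 1 + k) := fun k => by
    have hk : 0 < α + 1 + k := by positivity
    rw [integral_const_mul, ← Real.Gamma_eq_integral (hpos k), Gamma_add_natCast_eq hk,
      Gamma_add_natCast_eq hα']
    have := (hasc k).ne'
    have : (k.factorial : ℝ) ≠ 0 := by positivity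
    field_simp
  have hnorm : ∀ k, ∫ x in Set.Ioi 0, ‖F k x‖ = ∫ x in Set.Ioi 0, F k x := fun k => by
    refine setIntegral_congr_fun measurableSet_Ioi fun x hx => ?_
    have := hasc k
    have hx : 0 < x := hx
    exact Real.norm_of_nonneg (by positivity)
  have hsum := hasSum_momentPoly b j (α + 1)
  have hS := hasSum_integral_of_summable_integral_norm (μ := volume.restrict (Set.Ioi 0)) hF
    (by simpa only [hnorm, hFint] using hsum.summable)
  simp only [hFint] at hS
  rw [integral_Ici_eq_integral_Ioi, hsum.unique hS]
  refine setIntegral_congr_fun measurableSet_Ioi fun x hx => ?_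
  have hx : 0 < x := hx
  simp only [chiralWeight, hyp0F1, F]
  rw [← mul_assoc, ← tsum_mul_left]
  congr 1
  funext k
  have e : (α + 1 + k + j : ℝ) - 1 = α + k + j := by ring
  rw [e, Real.rpow_add hx, Real.rpow_add hx, Real.rpow_natCast, Real.rpow_natCast, mul_pow]
  have := (hasc k).ne'
  have : (k.factorial : ℝ) ≠ 0 := by positivity
  field_simp

theorem integrableOn_pow_mul_chiralWeight {α : ℝ} (hα : -1 < α) {b : ℝ} (hb : 0 ≤ b) (j : ℕ) :
    IntegrableOn (fun x : ℝ => x ^ j * chiralWeight α b x) (Set.Ici 0) := by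
  -- A non-integrable function has Bochner integral `0` by convention, whereas this moment is a sum
  -- of nonnegative terms with positive first term.
  refine Integrable.of_integral_ne_zero ?_
  rw [integral_pow_mul_chiralWeight hα hb, ← (hasSum_momentPoly b j (α + 1)).tsum_eq]
  refine ne_of_gt ((hasSum_momentPoly b j (α + 1)).summable.tsum_pos (fun k => ?_) 0 ?_)
  · have := ascPochhammer_pos j (α + 1 + k) (by positivity [show 0 < α + 1 by linarith])
    positivity
  · simpa using ascPochhammer_pos j (α + 1) (by linarith)

/-- The linear map `T` with `∫ x in Ici 0, p x * chiralWeight α b x = exp b * (T p) b`. -/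
noncomputable def momentTransform (α : ℝ) : ℝ[X] →ₗ[ℝ] ℝ[X] :=
  Polynomial.lsum fun j => LinearMap.toSpanSingleton ℝ ℝ[X] (momentPoly j (α + 1))

theorem momentTransform_monomial (α : ℝ) (j : ℕ) (r : ℝ) :
    momentTransform α (monomial j r) = r • momentPoly j (α + 1) := by
  simp [momentTransform, Polynomial.lsum_apply, sum_monomial_index]

/-- The two claims are proved together because the additive step for the integral needs
integrability of both summands. -/
theorem chiralWeight_integral_aux {α : ℝ} (hα : -1 < α) {b : ℝ} (hb : 0 ≤ b) (p : ℝ[X]) :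
    IntegrableOn (fun x : ℝ => p.eval x * chiralWeight α b x) (Set.Ici 0) ∧
      ∫ x in Set.Ici 0, p.eval x * chiralWeight α b x =
        Real.exp b * (momentTransform α p).eval b := by
  induction p using Polynomial.induction_on' with
  | add p q hp hq =>
    simp only [eval_add, add_mul, map_add, mul_add]
    exact ⟨hp.1.add hq.1, by rw [integral_add hp.1 hq.1, hp.2, hq.2]⟩
  | monomial j r =>
    simp only [eval_monomial, momentTransform_monomial, mul_assoc]
    refine ⟨(integrableOn_pow_mul_chiralWeight hα hb j).const_mul r, ?_⟩
    rw [integral_const_mul, integral_pow_mul_chiralWeight hα hb, eval_smul, smul_eq_mul]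
    ring

theorem integrableOn_eval_mul_chiralWeight {α : ℝ} (hα : -1 < α) {b : ℝ} (hb : 0 ≤ b) (p : ℝ[X]) :
    IntegrableOn (fun x : ℝ => p.eval x * chiralWeight α b x) (Set.Ici 0) :=
  (chiralWeight_integral_aux hα hb p).1

theorem integral_eval_mul_chiralWeight {α : ℝ} (hα : -1 < α) {b : ℝ} (hb : 0 ≤ b) (p : ℝ[X]) :
    ∫ x in Set.Ici 0, p.eval x * chiralWeight α b x =
      Real.exp b * (momentTransform α p).eval b :=
  (chiralWeight_integral_aux hα hb p).2

/-! ### The transform preserves degrees and leading coefficients -/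

theorem momentTransform_natDegree_coeff (α : ℝ) {p : ℝ[X]} {n : ℕ} (hp : p.natDegree ≤ n) :
    (momentTransform α p).natDegree ≤ n ∧ (momentTransform α p).coeff n = p.coeff n := by
  have hT : momentTransform α p =
      ∑ j ∈ Finset.range (n + 1), p.coeff j • momentPoly j (α + 1) := by
    conv_lhs => rw [as_sum_range' p (n + 1) (by omega), map_sum]
    exact Finset.sum_congr rfl fun j _ => momentTransform_monomial α j _
  rw [hT]
  constructor
  · refine natDegree_sum_le_of_forall_le _ _ fun j hj => ?_
    refine (natDegree_smul_le _ _).trans ?_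
    rw [(momentPoly_monic_natDegree j _).2]
    simp at hj
    omega
  · rw [finsetSum_coeff, Finset.sum_range_succ, Finset.sum_eq_zero, zero_add]
    · have h := momentPoly_monic_natDegree n (α + 1)
      have h1 := h.1.coeff_natDegree
      rw [h.2] at h1
      simp [h1]
    · intro j hj
      rw [coeff_smul, coeff_eq_zero_of_natDegree_lt (p := momentPoly j _), smul_zero]
      rw [(momentPoly_monic_natDegree j _).2]
      simpa using hj

theorem momentTransform_monic (α : ℝ) {p : ℝ[X]} (hp : p.Monic) :
    (momentTransform α p).Monic ∧ (momentTransform α p).natDegree = p.natDegree := by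
  obtain ⟨h1, h2⟩ := momentTransform_natDegree_coeff α le_rfl (p := p)
  rw [hp.coeff_natDegree] at h2
  exact ⟨monic_of_natDegree_le_of_coeff_eq_one _ h1 h2,
    natDegree_eq_of_le_of_coeff_ne_zero h1 (by simp [h2])⟩

theorem momentTransform_injective (α : ℝ) : Function.Injective (momentTransform α) := by
  rw [← LinearMap.ker_eq_bot, LinearMap.ker_eq_bot']
  intro p hp
  have h := (momentTransform_natDegree_coeff α le_rfl (p := p)).2
  rw [hp, coeff_zero] at h
  exact leadingCoeff_eq_zero.mp h.symm

/-- The transform restricts to an injective endomorphism of a finite-dimensional space, hence a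
surjective one. -/
theorem exists_momentTransform_eq (α : ℝ) {n : ℕ} {q : ℝ[X]} (hq : q.degree < n) :
    ∃ p : ℝ[X], p.degree < n ∧ momentTransform α p = q := by
  have hmap : ∀ p : degreeLT ℝ n, momentTransform α p ∈ degreeLT ℝ n := fun ⟨p, hp⟩ => by
    rw [mem_degreeLT] at hp ⊢
    obtain _ | n := n
    · have : p = 0 := by simpa using hp
      simp [this]
    · have hp' : p.natDegree ≤ n := natDegree_le_iff_coeff_eq_zero.mpr fun m hm =>
        coeff_eq_zero_of_degree_lt (hp.trans_le (by exact_mod_cast hm))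
      exact (degree_le_of_natDegree_le (momentTransform_natDegree_coeff α hp').1).trans_lt
        (by exact_mod_cast n.lt_succ_self)
  let T : degreeLT ℝ n →ₗ[ℝ] degreeLT ℝ n :=
    ((momentTransform α).domRestrict (degreeLT ℝ n)).codRestrict (degreeLT ℝ n) hmap
  have hinj : Function.Injective T := fun x y hxy =>
    Subtype.ext (momentTransform_injective α (congrArg Subtype.val hxy))
  have : FiniteDimensional ℝ (degreeLT ℝ n) := (degreeLTEquiv ℝ n).symm.finiteDimensional
  obtain ⟨p, hp⟩ := LinearMap.injective_iff_surjective.mp hinj ⟨q, mem_degreeLT.mpr hq⟩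
  exact ⟨p, mem_degreeLT.mp p.2, congrArg Subtype.val hp⟩

/-! ### Multiple functions for the nested multi-indices -/

/-- The first `k` elements of `Fin N`. -/
def initialIndices (N k : ℕ) : Finset (Fin N) := Finset.univ.filter fun i => (i : ℕ) < k

theorem mem_initialIndices {N k : ℕ} {i : Fin N} : i ∈ initialIndices N k ↔ (i : ℕ) < k := by
  simp [initialIndices]

theorem card_initialIndices {N k : ℕ} (hk : k ≤ N) : (initialIndices N k).card = k := by
  rw [initialIndices, Fin.card_filter_val_lt, min_eq_right hk]

theorem multiIndexWeight_nestedIndex {N k : ℕ} (hk : k ≤ N) :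
    multiIndexWeight (nestedIndex N k) = k := by
  rw [multiIndexWeight]
  simp only [nestedIndex, Finset.sum_boole]
  exact_mod_cast card_initialIndices hk

section Nested

variable {α : ℝ} {N k : ℕ} {a : Fin N → ℝ}

theorem isMultipleTypeII_nestedIndex_iff (hα : -1 < α) (ha : Function.Injective a)
    (ha0 : ∀ i, 0 ≤ a i) (hk : k ≤ N) {P : ℝ[X]} :
    IsMultipleTypeII (Set.Ici 0) (fun i => chiralWeight α (a i)) (nestedIndex N k) P ↔
      P.Monic ∧ P.natDegree = k ∧
        momentTransform α P = Lagrange.nodal (initialIndices N k) a := by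
  have hint : ∀ (i : Fin N), ∫ x in Set.Ici 0, chiralWeight α (a i) x * x ^ 0 * P.eval x =
      Real.exp (a i) * (momentTransform α P).eval (a i) := fun i => by
    rw [← integral_eval_mul_chiralWeight hα (ha0 i)]
    simp only [pow_zero, mul_one, mul_comm]
  constructor
  · rintro ⟨hm, hd, h0⟩
    rw [multiIndexWeight_nestedIndex hk] at hd
    refine ⟨hm, hd, ?_⟩
    obtain ⟨hTm, hTd⟩ := momentTransform_monic α hm
    -- Two monic polynomials of degree `k` differ by one of degree `< k`, so agreement at `k` nodes
    -- suffices.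
    refine Polynomial.eq_of_degree_sub_lt_of_eval_index_eq (initialIndices N k) ha.injOn ?_ ?_
    · have hTdeg : (momentTransform α P).degree = k := by
        rw [degree_eq_natDegree hTm.ne_zero, hTd, hd]
      rw [card_initialIndices hk, ← hTdeg]
      refine degree_sub_lt_left ?_ hTm.ne_zero
        (hTm.leadingCoeff.trans Lagrange.nodal_monic.leadingCoeff.symm)
      rw [Lagrange.degree_nodal, card_initialIndices hk, hTdeg]
    · intro i hi
      have h := h0 i 0 (by simp [nestedIndex, mem_initialIndices.mp hi])
      rw [hint] at h
      rw [Lagrange.eval_nodal_at_node hi]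
      exact (mul_eq_zero.mp h).resolve_left (Real.exp_ne_zero _)
  · rintro ⟨hm, hd, hT⟩
    refine ⟨hm, by rw [multiIndexWeight_nestedIndex hk, hd], fun i j hj => ?_⟩
    have hik : (i : ℕ) < k := by
      by_contra h
      simp [nestedIndex, h] at hj
    have hj0 : j = 0 := by
      simp only [nestedIndex, hik, if_true] at hj
      omega
    rw [hj0, hint, hT, Lagrange.eval_nodal_at_node (mem_initialIndices.mpr hik), mul_zero]

theorem existsUnique_isMultipleTypeII_nestedIndex (hα : -1 < α) (ha : Function.Injective a)
    (ha0 : ∀ i, 0 ≤ a i) (hk : k ≤ N) :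
    ∃! P : ℝ[X],
      IsMultipleTypeII (Set.Ici 0) (fun i => chiralWeight α (a i)) (nestedIndex N k) P := by
  simp only [isMultipleTypeII_nestedIndex_iff hα ha ha0 hk]
  obtain ⟨p, hp, hpT⟩ := exists_momentTransform_eq α (n := k + 1)
    (q := Lagrange.nodal (initialIndices N k) a) (by
      rw [Lagrange.degree_nodal, card_initialIndices hk]
      exact_mod_cast k.lt_succ_self)
  have hpd : p.natDegree ≤ k := natDegree_le_iff_coeff_eq_zero.mpr fun m hm =>
    coeff_eq_zero_of_degree_lt (hp.trans_le (by exact_mod_cast hm))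
  have hc : p.coeff k = 1 := by
    have h1 := (Lagrange.nodal_monic (s := initialIndices N k) (v := a)).coeff_natDegree
    rw [Lagrange.natDegree_nodal, card_initialIndices hk] at h1
    rw [← (momentTransform_natDegree_coeff α hpd).2, hpT, h1]
  refine ⟨p, ⟨monic_of_natDegree_le_of_coeff_eq_one _ hpd hc,
    natDegree_eq_of_le_of_coeff_ne_zero hpd (by simp [hc]), hpT⟩, fun P hP => ?_⟩
  exact momentTransform_injective α (hP.2.2.trans hpT.symm)

/-- The constants which are the type I polynomials with multi-index `nestedIndex N k`. -/
noncomputable def typeICoeff (a : Fin N → ℝ) (k : ℕ) (i : Fin N) : ℝ :=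
  if (i : ℕ) < k then
    Real.exp (-a i) * (∏ j ∈ (initialIndices N k).erase i, (a i - a j))⁻¹ else 0

theorem typeICoeff_of_le {i : Fin N} (h : k ≤ i) : typeICoeff a k i = 0 :=
  if_neg (not_lt.mpr h)

theorem typeICoeff_mul_exp {i : Fin N} (h : (i : ℕ) < k) :
    typeICoeff a k i * Real.exp (a i) = (∏ j ∈ (initialIndices N k).erase i, (a i - a j))⁻¹ := by
  rw [typeICoeff, if_pos h, mul_right_comm, ← Real.exp_add, neg_add_cancel, Real.exp_zero, one_mul]

theorem prod_erase_sub_ne_zero (ha : Function.Injective a) (s : Finset (Fin N)) (i : Fin N) :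
    ∏ j ∈ s.erase i, (a i - a j) ≠ 0 :=
  Finset.prod_ne_zero_iff.mpr fun _ hj =>
    sub_ne_zero.mpr fun h => (Finset.mem_erase.mp hj).1 (ha h).symm

theorem sum_eq_sum_initialIndices {f : Fin N → ℝ} (hf : ∀ i : Fin N, k ≤ i → f i = 0) :
    ∑ i, f i = ∑ i ∈ initialIndices N k, f i :=
  (Finset.sum_subset (Finset.subset_univ _) fun i _ hi =>
    hf i (not_lt.mp fun h => hi (mem_initialIndices.mpr h))).symm

/-- This reads off the top coefficient of the Lagrange interpolant. For `k = 0` the truncated `k -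
1` is harmless, since `q = 0`. -/
theorem sum_typeICoeff_mul_eval (ha : Function.Injective a) (hk : k ≤ N) {q : ℝ[X]}
    (hq : q.degree < k) :
    ∑ i, typeICoeff a k i * Real.exp (a i) * q.eval (a i) = q.coeff (k - 1) := by
  rw [sum_eq_sum_initialIndices (k := k) fun i hi => by rw [typeICoeff_of_le hi, zero_mul, zero_mul]]
  have h := Lagrange.coeff_eq_sum (s := initialIndices N k) ha.injOn
    (by rwa [card_initialIndices hk])
  rw [card_initialIndices hk] at h
  rw [h]
  refine Finset.sum_congr rfl fun i hi => ?_
  rw [typeICoeff_mul_exp (mem_initialIndices.mp hi), div_eq_mul_inv, mul_comm]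

/-- Testing on the nodal polynomial of the first `k` nodes with `a i` omitted isolates `d i`. -/
theorem eq_typeICoeff (ha : Function.Injective a) (hk : k ≤ N) {d : Fin N → ℝ}
    (hd : ∀ i : Fin N, k ≤ i → d i = 0)
    (h : ∀ q : ℝ[X], q.degree < k → ∑ i, d i * Real.exp (a i) * q.eval (a i) = q.coeff (k - 1)) :
    d = typeICoeff a k := by
  funext i
  by_cases hi : (i : ℕ) < k
  · have hi' := mem_initialIndices.mpr hi
    have hdeg : (Lagrange.nodal ((initialIndices N k).erase i) a).degree = (k - 1 : ℕ) := by
      rw [Lagrange.degree_nodal, Finset.card_erase_of_mem hi', card_initialIndices hk]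
    have hlt : (Lagrange.nodal ((initialIndices N k).erase i) a).degree < k := by
      rw [hdeg]
      exact_mod_cast (by omega : k - 1 < k)
    have hsum := (h _ hlt).trans (sum_typeICoeff_mul_eval ha hk hlt).symm
    have hz : ∀ e : Fin N → ℝ, (∀ i : Fin N, k ≤ i → e i = 0) →
        ∑ l, e l * Real.exp (a l) * (Lagrange.nodal ((initialIndices N k).erase i) a).eval (a l) =
          e i * Real.exp (a i) * (Lagrange.nodal ((initialIndices N k).erase i) a).eval (a i) := by
      intro e he
      refine Finset.sum_eq_single i (fun l _ hl => ?_) (by simp)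
      by_cases hlk : (l : ℕ) < k
      · rw [Lagrange.eval_nodal_at_node
          (Finset.mem_erase.mpr ⟨hl, mem_initialIndices.mpr hlk⟩), mul_zero]
      · rw [he l (not_lt.mp hlk), zero_mul, zero_mul]
    rw [hz d hd, hz _ fun i => typeICoeff_of_le, Lagrange.eval_nodal] at hsum
    exact mul_right_cancel₀ (Real.exp_ne_zero _)
      (mul_right_cancel₀ (prod_erase_sub_ne_zero ha _ i) hsum)
  · rw [hd i (not_lt.mp hi), typeICoeff_of_le (not_lt.mp hi)]

theorem integral_eval_mul_typeIFunction_C (hα : -1 < α) (ha0 : ∀ i, 0 ≤ a i) (d : Fin N → ℝ)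
    (p : ℝ[X]) :
    ∫ x in Set.Ici 0, p.eval x * typeIFunction (fun i => chiralWeight α (a i)) (fun i => C (d i)) x =
      ∑ i, d i * Real.exp (a i) * (momentTransform α p).eval (a i) := by
  have h : ∀ x, p.eval x * typeIFunction (fun i => chiralWeight α (a i)) (fun i => C (d i)) x =
      ∑ i, d i * (p.eval x * chiralWeight α (a i) x) := fun x => by
    simp only [typeIFunction, eval_C, Finset.mul_sum]
    exact Finset.sum_congr rfl fun i _ => by ring
  simp only [h]
  rw [integral_finsetSum _ fun i _ =>
    (integrableOn_eval_mul_chiralWeight hα (ha0 i) p).const_mul (d i)]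
  refine Finset.sum_congr rfl fun i _ => ?_
  rw [integral_const_mul, integral_eval_mul_chiralWeight hα (ha0 i), mul_assoc]

theorem isMultipleTypeI_nestedIndex_iff (hα : -1 < α) (ha : Function.Injective a)
    (ha0 : ∀ i, 0 ≤ a i) (hk : k ≤ N) {A : Fin N → ℝ[X]} :
    IsMultipleTypeI (Set.Ici 0) (fun i => chiralWeight α (a i)) (nestedIndex N k) A ↔
      A = fun i => C (typeICoeff a k i) := by
  have hint : ∀ (d : Fin N → ℝ) (j : ℕ), ∫ x in Set.Ici 0,
      x ^ j * typeIFunction (fun i => chiralWeight α (a i)) (fun i => C (d i)) x =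
        ∑ i, d i * Real.exp (a i) * (momentTransform α (X ^ j)).eval (a i) := fun d j => by
    rw [← integral_eval_mul_typeIFunction_C hα ha0]
    simp only [eval_pow, eval_X]
  constructor
  · rintro ⟨hdeg, h0, h1⟩
    rw [multiIndexWeight_nestedIndex hk] at h0 h1
    obtain ⟨d, rfl⟩ : ∃ d : Fin N → ℝ, A = fun i => C (d i) := by
      refine ⟨fun i => (A i).coeff 0, funext fun i => eq_C_of_degree_le_zero ?_⟩
      have h := hdeg i
      have h2 : nestedIndex N k i ≤ 1 := by rw [nestedIndex]; split_ifs <;> omega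
      refine degree_le_of_natDegree_le (natDegree_le_iff_coeff_eq_zero.mpr fun m hm => ?_)
      exact coeff_eq_zero_of_degree_lt (h.trans_le (by exact_mod_cast h2.trans hm))
    have hd : ∀ i : Fin N, k ≤ i → d i = 0 := fun i hi => by
      have h := hdeg i
      simpa [nestedIndex, not_lt.mpr hi] using h
    rw [eq_typeICoeff ha hk hd]
    intro q hq
    -- The moment conditions concern the images `T (X ^ j)`; by surjectivity and linearity of `T`
    -- they determine the functional on every `q`, and `T` does not change the top coefficient.
    obtain ⟨p, hp, rfl⟩ := exists_momentTransform_eq α hq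
    obtain _ | k := k
    · have : p = 0 := by simpa using hp
      simp [this]
    have hp' : p.natDegree ≤ k := natDegree_le_iff_coeff_eq_zero.mpr fun m hm =>
      coeff_eq_zero_of_degree_lt (hp.trans_le (by exact_mod_cast hm))
    rw [Nat.add_sub_cancel, (momentTransform_natDegree_coeff α hp').2]
    conv_lhs => rw [as_sum_range_C_mul_X_pow' p (Nat.lt_succ_of_le hp')]
    simp only [C_mul', map_sum, map_smul, eval_finsetSum, eval_smul, smul_eq_mul, Finset.mul_sum]
    rw [Finset.sum_comm]
    have hj : ∀ j, ∑ i, d i * Real.exp (a i) *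
        (p.coeff j * (momentTransform α (X ^ j)).eval (a i)) = p.coeff j *
        ∑ i, d i * Real.exp (a i) * (momentTransform α (X ^ j)).eval (a i) := fun j => by
      rw [Finset.mul_sum]
      exact Finset.sum_congr rfl fun i _ => by ring
    simp only [hj, ← hint]
    rw [Finset.sum_range_succ, h1 k rfl, mul_one, Finset.sum_eq_zero, zero_add]
    intro j hjk
    rw [h0 j (by simpa using hjk), mul_zero]
  · rintro rfl
    refine ⟨fun i => ?_, fun j hj => ?_, fun j hj => ?_⟩
    · by_cases hi : (i : ℕ) < k
      · simp only [nestedIndex, hi, if_true]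
        exact degree_C_le.trans_lt (by norm_num)
      · simp [typeICoeff_of_le (not_lt.mp hi), nestedIndex, hi]
    all_goals
      rw [multiIndexWeight_nestedIndex hk] at hj
      have hT := momentTransform_monic α (monic_X_pow (R := ℝ) j)
      rw [natDegree_X_pow] at hT
      rw [hint, sum_typeICoeff_mul_eval ha hk]
    · exact coeff_eq_zero_of_natDegree_lt (by omega)
    · rw [degree_eq_natDegree hT.1.ne_zero, hT.2]
      exact_mod_cast (by omega : j < k)
    · have := hT.1.coeff_natDegree
      rw [hT.2] at this
      rwa [show k - 1 = j by omega]
    · rw [degree_eq_natDegree hT.1.ne_zero, hT.2]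
      exact_mod_cast (by omega : j < k)

end Nested

/-! ### The kernel -/

/-- Change of basis: `h` forces `V⁻¹ = Dᵀ F`, and `(E V)⁻¹ E = V⁻¹` does not depend on `E`. -/
theorem transpose_inv_mul_eq {n : Type*} [Fintype n] [DecidableEq n] {E F D V : Matrix n n ℝ}
    (hE : (E * V).det ≠ 0) (h : F * V * D.transpose = 1) :
    E.transpose * ((E * V)⁻¹).transpose = F.transpose * D := by
  have h1 : V * (D.transpose * F) = 1 := by
    rw [← Matrix.mul_assoc]
    rw [Matrix.mul_assoc] at h
    exact mul_eq_one_comm.mp h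
  have h2 : (E * V)⁻¹ * E = D.transpose * F :=
    calc (E * V)⁻¹ * E = (E * V)⁻¹ * (E * (V * (D.transpose * F))) := by rw [h1, Matrix.mul_one]
      _ = D.transpose * F := by
        rw [← Matrix.mul_assoc E, ← Matrix.mul_assoc, Matrix.nonsing_inv_mul _
          (isUnit_iff_ne_zero.mpr hE), Matrix.one_mul]
  rw [← Matrix.transpose_mul, h2, Matrix.transpose_mul, Matrix.transpose_transpose]

theorem eval_eq_sum_fin {N : ℕ} {p : ℝ[X]} (hp : p.natDegree < N) (x : ℝ) :
    p.eval x = ∑ j : Fin N, p.coeff j * x ^ (j : ℕ) := by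
  rw [eval_eq_sum_range' hp, Finset.sum_range]

/-- The monic multiple of the associated Laguerre polynomial. -/
noncomputable def monicLaguerre (α : ℝ) (k : ℕ) : ℝ[X] :=
  C ((-1) ^ k * (k.factorial : ℝ)) * assocLaguerre α k

theorem chiralEta_eq_eval (α : ℝ) (k : ℕ) (x : ℝ) : chiralEta α k x = (monicLaguerre α k).eval x := by
  simp [chiralEta, monicLaguerre]

theorem monicLaguerre_monic_natDegree {α : ℝ} (hα : -1 < α) (k : ℕ) :
    (monicLaguerre α k).Monic ∧ (monicLaguerre α k).natDegree = k := by
  have h1 : (monicLaguerre α k).natDegree ≤ k := by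
    refine (natDegree_C_mul_le _ _).trans (natDegree_sum_le_of_forall_le _ _ fun j hj => ?_)
    exact (natDegree_C_mul_X_pow_le _ _).trans (by simp at hj; omega)
  have h2 : (monicLaguerre α k).coeff k = 1 := by
    have hΓ : Real.Gamma (k + α + 1) ≠ 0 :=
      (Real.Gamma_pos_of_pos (by have : (0 : ℝ) ≤ k := k.cast_nonneg; linarith)).ne'
    have hk : (k.factorial : ℝ) ≠ 0 := by positivity
    have hs : ((-1 : ℝ) ^ k) * (-1) ^ k = 1 := by rw [← mul_pow]; simp
    rw [monicLaguerre, coeff_C_mul, assocLaguerre, finsetSum_coeff,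
      Finset.sum_eq_single k (fun j _ hj => by simp [coeff_X_pow, hj.symm]) (by simp)]
    simp only [coeff_C_mul, coeff_X_pow_self, Nat.sub_self, Nat.factorial_zero, Nat.cast_one]
    field_simp
    linear_combination hs
  exact ⟨monic_of_natDegree_le_of_coeff_eq_one _ h1 h2,
    natDegree_eq_of_le_of_coeff_ne_zero h1 (by simp [h2])⟩

theorem pairingMatrix_chiral_apply {α : ℝ} (hα : -1 < α) {N : ℕ} {a : Fin N → ℝ}
    (ha0 : ∀ i, 0 ≤ a i) (i j : Fin N) :
    pairingMatrix (Set.Ici 0) (fun i : Fin N => chiralEta α i) (fun i => chiralWeight α (a i)) i j =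
      Real.exp (a j) * (momentTransform α (monicLaguerre α i)).eval (a j) := by
  simp only [pairingMatrix, Matrix.of_apply, chiralEta_eq_eval]
  exact integral_eval_mul_chiralWeight hα (ha0 j) _

/-- Monic polynomials of degrees `0, …, N - 1` evaluated at the nodes have the Vandermonde
determinant. -/
theorem pairingMatrix_chiral_det_ne_zero {α : ℝ} (hα : -1 < α) {N : ℕ} {a : Fin N → ℝ}
    (ha : Function.Injective a) (ha0 : ∀ i, 0 ≤ a i) :
    (pairingMatrix (Set.Ici 0) (fun i : Fin N => chiralEta α i)
      (fun i => chiralWeight α (a i))).det ≠ 0 := by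
  have hT : ∀ i : ℕ, _ := fun i =>
    momentTransform_monic α (monicLaguerre_monic_natDegree hα i).1
  have h : (pairingMatrix (Set.Ici 0) (fun i : Fin N => chiralEta α i)
      (fun i => chiralWeight α (a i))).transpose = Matrix.diagonal (fun i => Real.exp (a i)) *
        Matrix.of fun i j : Fin N => (momentTransform α (monicLaguerre α j)).eval (a i) := by
    ext i j
    rw [Matrix.transpose_apply, pairingMatrix_chiral_apply hα ha0, Matrix.diagonal_mul,
      Matrix.of_apply]
  rw [← Matrix.det_transpose, h, Matrix.det_mul, Matrix.det_diagonal,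
    ← Matrix.det_eval_matrixOfPolynomials_eq_det_vandermonde a
      (fun j : Fin N => momentTransform α (monicLaguerre α j))
      (fun i => (hT i).2.trans (monicLaguerre_monic_natDegree hα i).2) (fun i => (hT i).1)]
  exact mul_ne_zero (Finset.prod_ne_zero_iff.mpr fun i _ => Real.exp_ne_zero _)
    (Matrix.det_vandermonde_ne_zero_iff.mpr ha)

theorem sum_coeff_mul_moment {α : ℝ} {N : ℕ} {p : ℝ[X]} (hp : p.natDegree < N) (b : ℝ) :
    ∑ j : Fin N, p.coeff j * (Real.exp b * (momentTransform α (X ^ (j : ℕ))).eval b) =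
      Real.exp b * (momentTransform α p).eval b := by
  conv_rhs => rw [as_sum_range_C_mul_X_pow' p hp, Finset.sum_range]
  simp only [C_mul', map_sum, map_smul, eval_finsetSum, eval_smul, smul_eq_mul, Finset.mul_sum]
  exact Finset.sum_congr rfl fun j _ => by ring

theorem chiralKernel_eq_sum {α : ℝ} (hα : -1 < α) {N : ℕ} {a : Fin N → ℝ}
    (ha : Function.Injective a) (ha0 : ∀ i, 0 ≤ a i) (P : ℕ → ℝ[X]) (A : ℕ → Fin N → ℝ[X])
    (hP : ∀ i < N, IsMultipleTypeII (Set.Ici 0) (fun j => chiralWeight α (a j))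
      (nestedIndex N i) (P i))
    (hA : ∀ i < N, IsMultipleTypeI (Set.Ici 0) (fun j => chiralWeight α (a j))
      (nestedIndex N (i + 1)) (A i)) (x y : ℝ) :
    chiralKernel α a x y = ∑ i ∈ Finset.range N,
      (P i).eval x * typeIFunction (fun j => chiralWeight α (a j)) (A i) y := by
  -- `E` and `F` expand the `η`'s and the `P`'s in monomials, `D` expands the `Q`'s in the weights,
  -- and `V` pairs monomials with weights.
  let E : Matrix (Fin N) (Fin N) ℝ := Matrix.of fun i j => (monicLaguerre α i).coeff j
  let F : Matrix (Fin N) (Fin N) ℝ := Matrix.of fun i j => (P i).coeff j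
  let D : Matrix (Fin N) (Fin N) ℝ := Matrix.of fun i j => typeICoeff a (i + 1) j
  let V : Matrix (Fin N) (Fin N) ℝ := Matrix.of fun i j =>
    Real.exp (a j) * (momentTransform α (X ^ (i : ℕ))).eval (a j)
  have hLdeg : ∀ i : Fin N, (monicLaguerre α i).natDegree < N := fun i => by
    rw [(monicLaguerre_monic_natDegree hα i).2]
    exact i.2
  have hP' : ∀ i : Fin N, _ := fun i =>
    (isMultipleTypeII_nestedIndex_iff hα ha ha0 i.2.le).mp (hP i i.2)
  have hPdeg : ∀ i : Fin N, (P i).natDegree < N := fun i => by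
    rw [(hP' i).2.1]
    exact i.2
  have hG : pairingMatrix (Set.Ici 0) (fun i : Fin N => chiralEta α i)
      (fun i => chiralWeight α (a i)) = E * V := by
    ext i j
    rw [pairingMatrix_chiral_apply hα ha0, Matrix.mul_apply]
    exact (sum_coeff_mul_moment (hLdeg i) _).symm
  -- The entry `(i, l)` is `∫ P_i Q_l`. For `l < i` every node occurring in `Q_l` is a root of `T
  -- P_i`; for `l ≥ i` the entry is the coefficient of `X ^ l` in the monic `T P_i` of degree `i`.
  have hFVD : F * V * D.transpose = 1 := by
    ext i l
    have hFV : ∀ j, (F * V) i j = Real.exp (a j) * (momentTransform α (P i)).eval (a j) :=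
      fun j => by
        rw [Matrix.mul_apply]
        exact sum_coeff_mul_moment (hPdeg i) _
    rw [Matrix.mul_apply]
    have hs : ∑ j, (F * V) i j * D.transpose j l = ∑ j, typeICoeff a (l + 1) j * Real.exp (a j) *
        (momentTransform α (P i)).eval (a j) :=
      Finset.sum_congr rfl fun j _ => by
        rw [hFV, Matrix.transpose_apply, show D l j = typeICoeff a (l + 1) j from rfl]
        ring
    rw [hs]
    obtain ⟨hm, hd, hT⟩ := hP' i
    rcases lt_or_ge (l : ℕ) i with hli | hil
    · rw [Matrix.one_apply_ne (by intro h; simp [h] at hli)]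
      refine Finset.sum_eq_zero fun j _ => ?_
      by_cases hj : (j : ℕ) < i
      · rw [hT, Lagrange.eval_nodal_at_node (mem_initialIndices.mpr hj), mul_zero]
      · rw [typeICoeff_of_le (by omega), zero_mul, zero_mul]
    · obtain ⟨hTm, hTd⟩ := momentTransform_monic α hm
      rw [hd] at hTd
      rw [sum_typeICoeff_mul_eval ha (Nat.succ_le_of_lt l.2), Nat.succ_sub_one]
      · rcases hil.eq_or_lt with h | h
        · have h' : i = l := Fin.ext h
          subst h'
          rw [Matrix.one_apply_eq]
          simpa [hTd] using hTm.coeff_natDegree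
        · rw [Matrix.one_apply_ne (by intro h'; simp [h'] at h)]
          exact coeff_eq_zero_of_natDegree_lt (by omega)
      · rw [degree_eq_natDegree hTm.ne_zero, hTd]
        exact_mod_cast Nat.lt_succ_of_le hil
  have hdet := pairingMatrix_chiral_det_ne_zero hα ha ha0
  rw [hG] at hdet
  have key := transpose_inv_mul_eq hdet hFVD
  have hη : (fun i : Fin N => chiralEta α i x) = Matrix.vecMul (fun j : Fin N => x ^ (j : ℕ))
      E.transpose := by
    funext i
    rw [chiralEta_eq_eval, eval_eq_sum_fin (hLdeg i)]
    simp [Matrix.vecMul, dotProduct, E, mul_comm]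
  have hPv : (fun i : Fin N => (P i).eval x) = Matrix.vecMul (fun j : Fin N => x ^ (j : ℕ))
      F.transpose := by
    funext i
    rw [eval_eq_sum_fin (hPdeg i)]
    simp [Matrix.vecMul, dotProduct, F, mul_comm]
  have hQ : (fun i : Fin N => typeIFunction (fun j => chiralWeight α (a j)) (A i) y) =
      Matrix.mulVec D (fun j => chiralWeight α (a j) y) := by
    funext i
    rw [(isMultipleTypeI_nestedIndex_iff hα ha ha0 i.2).mp (hA i i.2)]
    simp [typeIFunction, Matrix.mulVec, dotProduct, D, mul_comm]
  calc chiralKernel α a x y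
      = dotProduct (fun i : Fin N => chiralEta α i x)
          (Matrix.mulVec ((E * V)⁻¹).transpose fun j => chiralWeight α (a j) y) := by
        simp only [chiralKernel, biorthogonalKernel, hG, dotProduct, Matrix.mulVec, Finset.mul_sum,
          mul_assoc]
    _ = dotProduct (fun i : Fin N => (P i).eval x)
          (fun i : Fin N => typeIFunction (fun j => chiralWeight α (a j)) (A i) y) := by
        rw [hη, hPv, hQ, ← Matrix.dotProduct_mulVec, ← Matrix.dotProduct_mulVec,
          Matrix.mulVec_mulVec, Matrix.mulVec_mulVec, key]
    _ = _ := by rw [Finset.sum_range]; rfl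

theorem mainTheorem5 (α : ℝ) (hα : -1 < α) (N : ℕ) (a : Fin N → ℝ) (ha : StrictAnti a)
    (ha_nonneg : ∀ i, 0 ≤ a i) :
    -- all integrals converge, and the kernel is well defined
    (∀ (i : Fin N) (j : ℕ),
      IntegrableOn (fun x : ℝ => x ^ j * chiralWeight α (a i) x) (Set.Ici 0)) ∧
    (pairingMatrix (Set.Ici 0) (fun i : Fin N => chiralEta α i)
      (fun i => chiralWeight α (a i))).det ≠ 0 ∧
    -- the multiple functions of both types exist and are unique for the nested multi-indices
    (∀ k ≤ N, ∃! P : ℝ[X],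
      IsMultipleTypeII (Set.Ici 0) (fun i => chiralWeight α (a i)) (nestedIndex N k) P) ∧
    (∀ k ≤ N, ∃! A : Fin N → ℝ[X],
      IsMultipleTypeI (Set.Ici 0) (fun i => chiralWeight α (a i)) (nestedIndex N k) A) ∧
    -- the type I polynomials have the exact degrees `n i - 1`
    (∀ k ≤ N, ∀ A : Fin N → ℝ[X],
      IsMultipleTypeI (Set.Ici 0) (fun i => chiralWeight α (a i)) (nestedIndex N k) A →
        ∀ i : Fin N, (i : ℕ) < k → (A i).degree = 0) ∧
    -- the decomposition of the kernel
    (∀ (P : ℕ → ℝ[X]) (A : ℕ → Fin N → ℝ[X]),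
      (∀ i < N, IsMultipleTypeII (Set.Ici 0) (fun j => chiralWeight α (a j))
        (nestedIndex N i) (P i)) →
      (∀ i < N, IsMultipleTypeI (Set.Ici 0) (fun j => chiralWeight α (a j))
        (nestedIndex N (i + 1)) (A i)) →
      ∀ x y : ℝ, 0 ≤ x → 0 ≤ y →
        chiralKernel α a x y =
          ∑ i ∈ Finset.range N,
            (P i).eval x * typeIFunction (fun j => chiralWeight α (a j)) (A i) y) := by
  have ha' := ha.injective
  refine ⟨fun i j => integrableOn_pow_mul_chiralWeight hα (ha_nonneg i) j,
    pairingMatrix_chiral_det_ne_zero hα ha' ha_nonneg,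
    fun k hk => existsUnique_isMultipleTypeII_nestedIndex hα ha' ha_nonneg hk,
    fun k hk => ?_, fun k hk A hA i hi => ?_,
    fun P A hP hA x y _ _ => chiralKernel_eq_sum hα ha' ha_nonneg P A hP hA x y⟩
  · simp only [isMultipleTypeI_nestedIndex_iff hα ha' ha_nonneg hk]
    exact existsUnique_eq
  · rw [(isMultipleTypeI_nestedIndex_iff hα ha' ha_nonneg hk).mp hA]
    refine degree_C ?_
    rw [typeICoeff, if_pos hi]
    exact mul_ne_zero (Real.exp_ne_zero _) (inv_ne_zero (prod_erase_sub_ne_zero ha' _ i))
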